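/- A string-link chord diagram with $k$ components and $n$ chords consists of $k$ line segments (the components), all oriented upwards, and $n$ chords whose $2n$ endpoints are distinct points of the components; it is determined by the order of the chord endpoints along each component. It is connected if it is non-empty and the union of its components and chords is connected. The 2-term relations identify two diagrams on the same components that differ only by sliding one end of a chord $a$ over another chord $b$: if $b_1,b_2$ are the two endpoints of $b$ (in either order, on the same component or on different ones), then the diagram in which the endpoint of $a$ lies directly below $b_1$ is identified with the diagram in which this endpoint lies directly above $b_2$. A caravan is a sequence of chords with all endpoints on one component which, read from bottom to top, consists of $m_1\ge 0$ isolated chords (endpoint pattern $a\,a$) followed by $m_2\ge 0$ pairs of crossing chords (endpoint pattern $a\,b\,a\,b$), placed side by side. **Theorem.** Every connected string-link chord diagram is equivalent, modulo the 2-term relations, to a chord diagram whose components can be renumbered $1,\dots,k$ in such a way that: * every chord either has both endpoints on component $1$, or has one endpoint on component $i$ and one on component $i+1$ for some $i$; * the chords with both endpoints on component $1$ are arranged in a caravan, and all of their endpoints lie below the endpoints on component $1$ of all other chords; * for each $i$ there are at most two chords between components $i$ and $i+1$, and if there are two, they do not cross: the endpoints of one lie above the endpoints of the other on both components; * on component $i$,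 the endpoints of the chords connecting component $i$ to component $i+1$ lie below the endpoints of the chords connecting component $i$ to component $i-1$. -/

import Mathlib

/-- A string-link chord diagram with `k` components (line segments oriented upwards, indexed by
`Fin k`) and `n` chords (named by `Fin n`).  The diagram is determined by the order of the chord
endpoints on each component: `word i` lists, from bottom to top, the chords to which the
successive endpoints on component `i` belong.  Every chord has exactly two endpoints. -/
@[ext]
structure ChordDiagram (k n : ℕ) where
  word : Fin k → List (Fin n)
  two_endpoints : ∀ c : Fin n, ∑ i, (word i).count c = 2

namespace ChordDiagram

variable {k n : ℕ}

/-- One endpoint of the chord `c` lies on component `i` and the other one on component `j`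
(both of them on component `i` if `i = j`). -/
def Joins (D : ChordDiagram k n) (c : Fin n) (i j : Fin k) : Prop :=
  ∀ l : Fin k, (D.word l).count c = (if l = i then 1 else 0) + (if l = j then 1 else 0)

/-- On component `i`, every endpoint of the chord `c` lies below every endpoint of the
chord `d`. -/
def Below (D : ChordDiagram k n) (i : Fin k) (c d : Fin n) : Prop :=
  ∀ p q : ℕ, (D.word i)[p]? = some c → (D.word i)[q]? = some d → p < q

/-- Two different components are adjacent if some chord has an endpoint on each of them. -/
def componentGraph (D : ChordDiagram k n) : SimpleGraph (Fin k) :=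
  SimpleGraph.fromRel (fun i j => ∃ c : Fin n, c ∈ D.word i ∧ c ∈ D.word j)

/-- The union of the components and the chords is connected (and not empty). -/
def IsConnected (D : ChordDiagram k n) : Prop :=
  D.componentGraph.Connected

/-- Renumbering of the components: component `i` of the new diagram is component `σ i` of the
old one. -/
def renumber (D : ChordDiagram k n) (σ : Equiv.Perm (Fin k)) : ChordDiagram k n where
  word i := D.word (σ i)
  two_endpoints c :=
    (Equiv.sum_comp σ (fun i => (D.word i).count c)).trans (D.two_endpoints c)

/-- A 2-term relation `D = D'`: one end of the chord `a` is slid over the chord `b`.  Here `W` is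
the common part of the two diagrams, that is, all endpoints except the moving endpoint of `a`.
The two endpoints of `b` are the entry number `p` of component `i` and the entry number `q` of
component `j` (`i = j` is allowed).  In `D` the moving endpoint of `a` lies directly below the
first endpoint of `b`, in `D'` directly above the second one.  Either endpoint of `b` may be the
first one, so this comprises both 2-term relations. -/
def TwoTerm (D D' : ChordDiagram k n) : Prop :=
  ∃ (W : Fin k → List (Fin n)) (a b : Fin n) (i j : Fin k) (p q : ℕ),
    (W i)[p]? = some b ∧ (W j)[q]? = some b ∧ (i, p) ≠ (j, q) ∧
    D.word = Function.update W i ((W i).insertIdx p a) ∧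
    D'.word = Function.update W j ((W j).insertIdx (q + 1) a)

/-- Equivalence modulo the 2-term relations: the equivalence relation that they generate. -/
def TwoTermEquiv (D D' : ChordDiagram k n) : Prop :=
  Relation.EqvGen TwoTerm D D'

/-- A caravan, read from bottom to top: one-humped camels (single chords `a a`), followed by
two-humped camels (pairs of crossing chords `a b a b`), side by side. -/
def IsCaravan (l : List (Fin n)) : Prop :=
  ∃ (ones : List (Fin n)) (twos : List (Fin n × Fin n)),
    l = ones.flatMap (fun a => [a, a]) ++
      twos.flatMap (fun t => [t.1, t.2, t.1, t.2])

/-- The endpoints on component `i`, from bottom to top, of the chords that have both endpoints on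
component `i`. -/
def loopWord (D : ChordDiagram k n) (i : Fin k) : List (Fin n) :=
  (D.word i).filter (fun c => (D.word i).count c = 2)

/-- The normal form of a string-link chord diagram.  Component 1 of the usual numbering
is the component with index `0`. -/
structure IsNormalForm (D : ChordDiagram k n) : Prop where
  /-- Every chord has both endpoints on the first component or joins consecutive components. -/
  chords : ∀ c : Fin n, (∃ i : Fin k, i.val = 0 ∧ D.Joins c i i) ∨
    ∃ i j : Fin k, j.val = i.val + 1 ∧ D.Joins c i j
  /-- The chords with both endpoints on the first component form a caravan. -/
  caravan : ∀ i : Fin k, i.val = 0 → IsCaravan (D.loopWord i)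
  /-- The endpoints of the caravan lie below the endpoints of the other chords. -/
  caravan_below : ∀ i : Fin k, i.val = 0 → ∀ c d : Fin n,
    D.Joins c i i → ¬ D.Joins d i i → D.Below i c d
  /-- At most two chords join a pair of consecutive components. -/
  at_most_two : ∀ i j : Fin k, j.val = i.val + 1 → {c : Fin n | D.Joins c i j}.ncard ≤ 2
  /-- Two chords that join the same two components do not cross. -/
  not_crossing : ∀ i j : Fin k, j.val = i.val + 1 → ∀ c d : Fin n, c ≠ d →
    D.Joins c i j → D.Joins d i j →
      (D.Below i c d ∧ D.Below j c d) ∨ (D.Below i d c ∧ D.Below j d c)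
  /-- On each component the chords to the next component lie below the chords to the previous
  component. -/
  next_below_previous : ∀ h i j : Fin k, i.val = h.val + 1 → j.val = i.val + 1 →
    ∀ c d : Fin n, D.Joins c i j → D.Joins d i h → D.Below i c d

end ChordDiagram

/-! The 2-term relations let chord ends travel over a chord, and three consequences carry the proof.

Contraction: if a chord joins two components, all other ends on one of them can be slid over it to
the other. By connectedness this can be repeated until a single component `r` is left, every other
component holding one end of a chord whose other end, a leg, lies on `r`
(`ConnectedOff.exists_star`).

Reduction on `r`: the word of `r` contains each leg once and every other chord twice. A segment
bounded by the two ends of one chord commutes with everything, and so does a crossing pair `a b a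
b`. Crossing pairs can therefore be split off as two-humped camels, and chords enclosing no leg
directly become one-humped camels. What cannot be split off is a tail of legs and nested humps, each
hump having a leg directly above its lower end (`IsClosedWord.hasCaravanForm`).

Unfolding: everything in the tail above its first leg slides over that leg to the component at its
other end, where the process repeats. If the leg is the first entry of a hump, the upper end of the
hump slides along, so that hump and leg become two parallel chords between consecutive components.
This yields a chain with links of at most two chords (`IsTail.unfoldsToChain`), which is the normal
form (`isNormalForm_of_chain`). -/

namespace ChordDiagram

/-! ### Slides within one component -/

section Words

variable {α : Type*}

/-- One slide of a chord end `x` over a chord `b` with both ends in the same word. -/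
inductive WordSlide : List α → List α → Prop
  | across (u v t : List α) (x b : α) :
      WordSlide (u ++ x :: b :: (v ++ b :: t)) (u ++ b :: (v ++ b :: x :: t))
  | inside (u v t : List α) (x b : α) :
      WordSlide (u ++ b :: (v ++ x :: b :: t)) (u ++ b :: x :: (v ++ b :: t))

/-- Equivalence of words under slides over chords with both ends in the word. -/
def WordEquiv (w w' : List α) : Prop := Relation.EqvGen WordSlide w w'

namespace WordEquiv

theorem refl (w : List α) : WordEquiv w w := Relation.EqvGen.refl w

theorem symm {w w' : List α} (h : WordEquiv w w') : WordEquiv w' w := Relation.EqvGen.symm _ _ h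

theorem trans {w w' w'' : List α} (h : WordEquiv w w') (h' : WordEquiv w' w'') :
    WordEquiv w w'' := Relation.EqvGen.trans _ _ _ h h'

instance : Trans (WordEquiv (α := α)) WordEquiv WordEquiv := ⟨trans⟩

theorem append_left (u : List α) {w w' : List α} (h : WordEquiv w w') :
    WordEquiv (u ++ w) (u ++ w') := by
  induction h with
  | rel _ _ h =>
    apply Relation.EqvGen.rel
    cases h with
    | across u' v t x b => simpa using WordSlide.across (u ++ u') v t x b
    | inside u' v t x b => simpa using WordSlide.inside (u ++ u') v t x b
  | refl => exact refl _
  | symm _ _ _ ih => exact ih.symm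
  | trans _ _ _ _ _ ih ih' => exact ih.trans ih'

theorem append_right {w w' : List α} (h : WordEquiv w w') (u : List α) :
    WordEquiv (w ++ u) (w' ++ u) := by
  induction h with
  | rel _ _ h =>
    apply Relation.EqvGen.rel
    cases h with
    | across u' v t x b => simpa using WordSlide.across u' v (t ++ u) x b
    | inside u' v t x b => simpa using WordSlide.inside u' v (t ++ u) x b
  | refl => exact refl _
  | symm _ _ _ ih => exact ih.symm
  | trans _ _ _ _ _ ih ih' => exact ih.trans ih'

theorem cons (x : α) {w w' : List α} (h : WordEquiv w w') : WordEquiv (x :: w) (x :: w') :=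
  h.append_left [x]

theorem perm {w w' : List α} (h : WordEquiv w w') : w.Perm w' := by
  induction h with
  | rel _ _ h =>
    classical
    rw [List.perm_iff_count]
    intro c
    cases h <;> simp [List.count_cons] <;> omega
  | refl => exact List.Perm.refl _
  | symm _ _ _ ih => exact ih.symm
  | trans _ _ _ _ _ ih ih' => exact ih.trans ih'

/-- A segment that begins and ends with the two ends of one chord commutes with every word. -/
theorem append_block_comm (p v : List α) (b : α) :
    WordEquiv (p ++ b :: (v ++ [b])) (b :: (v ++ [b]) ++ p) := by
  induction p with
  | nil => simpa using refl _
  | cons x p ih =>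
    refine (ih.cons x).trans ?_
    have h : WordEquiv _ _ := Relation.EqvGen.rel _ _ (WordSlide.across [] v p x b)
    simpa using h

/-- The segment between the two ends of a chord may be rotated. -/
theorem rotate (b : α) (v v' : List α) :
    WordEquiv (b :: (v ++ v' ++ [b])) (b :: (v' ++ v ++ [b])) := by
  induction v generalizing v' with
  | nil => simpa using refl _
  | cons x v ih =>
    -- Read backwards, this slide takes `x` from directly above the lower `b` to directly below the
    -- upper `b`.
    have h : WordEquiv _ _ := Relation.EqvGen.rel _ _ (WordSlide.inside [] (v ++ v') [] x b)
    refine (symm ?_).trans (ih (v' ++ [x])) |>.trans ?_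
    · simpa using h
    · simpa using refl _

/-- A pair of crossing chords commutes with every word. -/
theorem append_pair_comm (p : List α) (a b : α) :
    WordEquiv (p ++ [a, b, a, b]) ([a, b, a, b] ++ p) := by
  induction p with
  | nil => exact refl _
  | cons y p ih =>
    refine (ih.cons y).trans ?_
    -- The end `y` passes the pair by sliding over `a`, `b`, `a`, `b` in turn.
    calc WordEquiv (y :: ([a, b, a, b] ++ p)) (a :: b :: a :: y :: b :: p) :=
          Relation.EqvGen.rel _ _ (WordSlide.across [] [b] (b :: p) y a)
      WordEquiv _ (a :: b :: y :: a :: b :: p) :=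
          Relation.EqvGen.rel _ _ (WordSlide.inside [a] [a] p y b)
      WordEquiv _ (a :: y :: b :: a :: b :: p) :=
          Relation.EqvGen.rel _ _ (WordSlide.inside [] [b] (b :: p) y a)
      WordEquiv _ ([a, b, a, b] ++ y :: p) :=
          Relation.EqvGen.rel _ _ (WordSlide.across [a] [a] p y b)

/-- Two crossing chords can be separated from the rest of the word. -/
theorem separate_crossing (a c : α) (p q r s : List α) :
    WordEquiv (a :: (p ++ c :: q ++ a :: (r ++ c :: s))) ([a, c, a, c] ++ (r ++ q ++ p ++ s)) := by
  -- Rotating inside `a` brings `c` next to the lower `a`; rotating inside `c` then brings the upper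
  -- `a` next to this `c`. The block `a c a` moves up to the last `c`, and the completed pair moves
  -- back down.
  have h1 := (rotate a p (c :: q)).append_right (r ++ c :: s)
  have h2 := ((rotate c (q ++ p) (a :: r)).append_right s).cons a
  have h3 := (append_block_comm (r ++ q ++ p) [c] a).symm.append_right (c :: s)
  have h4 := (append_pair_comm (r ++ q ++ p) a c).append_right s
  simp only [List.append_assoc, List.cons_append, List.nil_append] at h1 h2 h3 h4 ⊢
  exact ((h1.trans h2).trans h3).trans h4

end WordEquiv

/-- A tail: a word made of legs (satisfying `L`) and humps, where every hump starts with a leg and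
is nested in all previous ones. -/
inductive IsTail (L : α → Prop) : List α → Prop
  | nil : IsTail L []
  | leg {z : α} {T : List α} : L z → IsTail L T → IsTail L (z :: T)
  | hump {a x : α} {T : List α} : ¬ L a → L x → IsTail L T → IsTail L (a :: x :: (T ++ [a]))

/-- Only a hump in `T₁` is an obstacle, since nothing may follow it in a tail. Legs of `T₂` pass
below it, and a hump of `T₂` is swallowed by moving the upper end of the first hump over it. -/
theorem IsTail.append {L : α → Prop} {T₁ T₂ : List α} (h₁ : IsTail L T₁) (h₂ : IsTail L T₂) :
    ∃ T, IsTail L T ∧ WordEquiv (T₁ ++ T₂) T := by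
  induction h₁ generalizing T₂ with
  | nil => exact ⟨T₂, h₂, .refl _⟩
  | leg hz _ ih =>
    obtain ⟨T, hT, hw⟩ := ih h₂
    exact ⟨_, hT.leg hz, hw.cons _⟩
  | @hump b y T hb hy hT ih =>
    induction h₂ with
    | nil => exact ⟨_, .hump hb hy hT, by simpa using .refl _⟩
    | @leg z T' hz _ ih' =>
      obtain ⟨T'', hT'', hw⟩ := ih'
      refine ⟨_, hT''.leg hz, .trans ?_ (hw.cons z)⟩
      have := (WordEquiv.append_block_comm [z] (y :: T) b).symm.append_right T'
      simpa using this
    | @hump a x T' ha hx hT' _ =>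
      obtain ⟨T'', hT'', hw⟩ := ih (.hump ha hx hT')
      refine ⟨_, .hump hb hy hT'', .trans ?_ ((hw.append_right [b]).append_left [b, y])⟩
      have := (WordEquiv.append_block_comm [b] (x :: T') a).append_left (b :: y :: T)
      simpa using this

end Words

/-! ### Caravan followed by a tail -/

section Caravan

variable {n : ℕ}

theorem IsCaravan.append_comm {K : List (Fin n)} (hK : IsCaravan K) (p : List (Fin n)) :
    WordEquiv (p ++ K) (K ++ p) := by
  have key : ∀ {A B : List (Fin n)}, (∀ p, WordEquiv (p ++ A) (A ++ p)) →
      (∀ p, WordEquiv (p ++ B) (B ++ p)) → ∀ p, WordEquiv (p ++ (A ++ B)) (A ++ B ++ p) := by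
    intro A B hA hB p
    have h1 := (hA p).append_right B
    have h2 := (hB p).append_left A
    simp only [List.append_assoc] at h1 h2 ⊢
    exact h1.trans h2
  obtain ⟨ones, twos, rfl⟩ := hK
  refine key (fun p => ?_) (fun p => ?_) p
  · induction ones generalizing p with
    | nil => simpa using .refl _
    | cons a l ih => exact key (fun p => WordEquiv.append_block_comm p [] a) ih p
  · induction twos generalizing p with
    | nil => simpa using .refl _
    | cons t l ih => exact key (fun p => WordEquiv.append_pair_comm p t.1 t.2) ih p

theorem IsCaravan.nil : IsCaravan ([] : List (Fin n)) := ⟨[], [], rfl⟩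

theorem IsCaravan.single (a : Fin n) : IsCaravan [a, a] := ⟨[a], [], rfl⟩

theorem IsCaravan.pair (a b : Fin n) : IsCaravan [a, b, a, b] := ⟨[], [(a, b)], rfl⟩

/-- The one-humped camels of `K₂` commute past the two-humped camels of `K₁`. -/
theorem IsCaravan.append {K₁ K₂ : List (Fin n)} (h₁ : IsCaravan K₁) (h₂ : IsCaravan K₂) :
    ∃ K, IsCaravan K ∧ WordEquiv (K₁ ++ K₂) K := by
  obtain ⟨o₁, t₁, rfl⟩ := h₁
  obtain ⟨o₂, t₂, rfl⟩ := h₂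
  refine ⟨_, ⟨o₁ ++ o₂, t₁ ++ t₂, rfl⟩, ?_⟩
  have hc : IsCaravan (o₂.flatMap fun a => [a, a]) := ⟨o₂, [], by simp⟩
  have := ((hc.append_comm (t₁.flatMap fun t => [t.1, t.2, t.1, t.2])).append_left
    (o₁.flatMap fun a => [a, a])).append_right (t₂.flatMap fun t => [t.1, t.2, t.1, t.2])
  simpa only [List.flatMap_append, List.append_assoc] using this

theorem IsCaravan.two_le_count {K : List (Fin n)} (hK : IsCaravan K) {c : Fin n} (hc : c ∈ K) :
    2 ≤ K.count c := by
  obtain ⟨ones, twos, rfl⟩ := hK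
  rw [List.count_append]
  rcases List.mem_append.1 hc with h | h
  · refine le_add_right ?_
    obtain ⟨a, ha, hca⟩ := List.mem_flatMap.1 h
    obtain ⟨l₁, l₂, rfl⟩ := List.append_of_mem ha
    obtain rfl : c = a := by simpa using hca
    simp
    omega
  · refine le_add_left ?_
    obtain ⟨t, ht, hct⟩ := List.mem_flatMap.1 h
    obtain ⟨l₁, l₂, rfl⟩ := List.append_of_mem ht
    simp only [List.flatMap_append, List.flatMap_cons, List.count_append]
    have : 2 ≤ [t.1, t.2, t.1, t.2].count c := by
      simp only [List.mem_cons, List.not_mem_nil, or_false] at hct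
      rcases hct with rfl | rfl | rfl | rfl <;> simp [List.count_cons] <;> omega
    omega

/-- The word is equivalent to a caravan followed by a tail. -/
def HasCaravanForm (L : Fin n → Prop) (w : List (Fin n)) : Prop :=
  ∃ K T, IsCaravan K ∧ IsTail L T ∧ WordEquiv w (K ++ T)

theorem HasCaravanForm.of_wordEquiv {L : Fin n → Prop} {w w' : List (Fin n)}
    (h : HasCaravanForm L w') (hw : WordEquiv w w') : HasCaravanForm L w := by
  obtain ⟨K, T, hK, hT, h⟩ := h
  exact ⟨K, T, hK, hT, hw.trans h⟩

theorem HasCaravanForm.caravan_append {L : Fin n → Prop} {K w : List (Fin n)}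
    (hK : IsCaravan K) (h : HasCaravanForm L w) : HasCaravanForm L (K ++ w) := by
  obtain ⟨K', T, hK', hT, h⟩ := h
  obtain ⟨K'', hK'', h''⟩ := hK.append hK'
  refine ⟨K'', T, hK'', hT, (h.append_left K).trans ?_⟩
  simpa using h''.append_right T

theorem HasCaravanForm.append {L : Fin n → Prop} {w w' : List (Fin n)}
    (h : HasCaravanForm L w) (h' : HasCaravanForm L w') : HasCaravanForm L (w ++ w') := by
  obtain ⟨K, T, hK, hT, h⟩ := h
  obtain ⟨K', T', hK', hT', h'⟩ := h'
  obtain ⟨T'', hT'', ht⟩ := hT.append hT'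
  refine ((HasCaravanForm.caravan_append hK' ⟨[], T'', .nil, hT'', .refl _⟩).caravan_append
    hK).of_wordEquiv ?_
  refine (h.append_right w').trans ((h'.append_left (K ++ T)).trans ?_)
  have h1 := ((hK'.append_comm T).append_right T').append_left K
  have h2 := (ht.append_left K').append_left K
  simp only [List.append_assoc] at h1 h2 ⊢
  exact h1.trans h2

/-- The caravan inside the chord `c` moves out below it. The remaining tail decides: if it is empty,
`c` is a camel; if it starts with a leg, `c` is a hump; if it is itself a hump, that block moves out
from under `c`, which again becomes a camel. -/
theorem HasCaravanForm.hump {L : Fin n → Prop} {w : List (Fin n)} {c : Fin n} (hc : ¬ L c)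
    (h : HasCaravanForm L w) : HasCaravanForm L (c :: (w ++ [c])) := by
  obtain ⟨K, T, hK, hT, h⟩ := h
  have h1 : WordEquiv (c :: (w ++ [c])) (K ++ c :: (T ++ [c])) := by
    refine ((h.append_right [c]).cons c).trans ?_
    simpa using (hK.append_comm [c]).append_right (T ++ [c])
  refine .of_wordEquiv (.caravan_append hK ?_) h1
  cases hT with
  | nil => exact ⟨_, [], .single c, .nil, .refl _⟩
  | leg hz hT => exact ⟨[], _, .nil, .hump hc hz hT, .refl _⟩
  | @hump b y T hb hy hT =>
    refine ⟨_, _, .single c, .hump hb hy hT, ?_⟩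
    have h1 := (WordEquiv.append_block_comm [c] (y :: T) b).append_right [c]
    have h2 := (IsCaravan.single c).append_comm (b :: y :: (T ++ [b]))
    simp only [List.append_assoc, List.cons_append, List.nil_append] at h1 h2 ⊢
    exact h1.trans h2

/-- The legs occur once and all other letters occur twice. -/
def IsClosedWord (L : Fin n → Prop) (w : List (Fin n)) : Prop :=
  ∀ c ∈ w, (L c → w.count c = 1) ∧ (¬ L c → w.count c = 2)

theorem IsClosedWord.perm {L : Fin n → Prop} {w w' : List (Fin n)} (h : IsClosedWord L w)
    (hp : w.Perm w') : IsClosedWord L w' := by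
  intro c hc
  rw [← hp.count_eq]
  exact h c (hp.mem_iff.2 hc)

theorem IsClosedWord.right_of_disjoint {L : Fin n → Prop} {u w : List (Fin n)}
    (h : IsClosedWord L (u ++ w)) (hd : ∀ c ∈ u, c ∉ w) : IsClosedWord L w := by
  intro c hc
  have h0 : u.count c = 0 := List.count_eq_zero.2 fun h' => hd c h' hc
  have := h c (by simp [hc])
  simpa [List.count_append, h0] using this

/-- Induction on the length, according to the lowest end `c`: a leg is peeled off, a chord crossed
by some `d` is split off together with `d`, and an uncrossed chord separates the word into two
closed words, inside and above. -/
theorem IsClosedWord.hasCaravanForm {L : Fin n → Prop} {w : List (Fin n)}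
    (h : IsClosedWord L w) : HasCaravanForm L w := by
  induction hl : w.length using Nat.strong_induction_on generalizing w with
  | _ m ih =>
  subst hl
  cases w with
  | nil => exact ⟨[], [], .nil, .nil, .refl _⟩
  | cons c w =>
    by_cases hc : L c
    · have h1 := (h c (by simp)).1 hc
      have hcl : IsClosedWord L w := IsClosedWord.right_of_disjoint (u := [c]) h (by
        intro d hd
        obtain rfl : d = c := by simpa using hd
        rw [← List.count_eq_zero]
        simpa using h1)
      have := ih _ (by simp) hcl rfl
      exact HasCaravanForm.append (w := [c]) ⟨[], [c], .nil, .leg hc .nil, .refl _⟩ this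
    · have h2 := (h c (by simp)).2 hc
      have hcw : c ∈ w := by
        rw [← List.count_pos_iff]
        rw [List.count_cons_self] at h2
        omega
      obtain ⟨v, t, rfl⟩ := List.append_of_mem hcw
      by_cases hx : ∃ d ∈ v, d ∈ t
      · obtain ⟨d, hdv, hdt⟩ := hx
        obtain ⟨p, q, rfl⟩ := List.append_of_mem hdv
        obtain ⟨r, s, rfl⟩ := List.append_of_mem hdt
        have hw := WordEquiv.separate_crossing c d p q r s
        have hcl := h.perm hw.perm
        refine .of_wordEquiv (.caravan_append (.pair c d) (ih _ ?_ ?_ rfl)) hw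
        · simp
          omega
        · refine hcl.right_of_disjoint fun e he he' => ?_
          -- Both ends of `e` are used up by the pair, and a closed word has no third occurrence.
          have h2 : 2 ≤ [c, d, c, d].count e := (IsCaravan.pair c d).two_le_count he
          have h3 := List.count_pos_iff.2 he'
          have h4 := hcl e (List.mem_append_left _ he)
          rw [List.count_append] at h4
          by_cases hLe : L e
          · have := h4.1 hLe
            omega
          · have := h4.2 hLe
            omega
      · have hd : ∀ d ∈ v, d ∉ t := fun d hd hd' => hx ⟨d, hd, hd'⟩
        have hvt : IsClosedWord L (v ++ t) := by
          refine IsClosedWord.right_of_disjoint (u := [c, c]) (h.perm ?_) ?_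
          · rw [List.perm_iff_count]
            intro e
            simp [List.count_cons]
            omega
          · intro e he
            obtain rfl : e = c := by simpa using he
            rw [← List.count_eq_zero]
            simp at h2 ⊢
            omega
        have ht := hvt.right_of_disjoint hd
        have hv : IsClosedWord L v := (hvt.perm List.perm_append_comm).right_of_disjoint
          fun e he he' => hd e he' he
        have h3 := (HasCaravanForm.hump hc (ih _ (by simp) hv rfl)).append
          (ih _ (by simp; omega) ht rfl)
        simpa using h3

end Caravan
-- Slides between components
section Slides

variable {k n : ℕ}

/-- The 2-term relation, stated for the families of words of the two diagrams. -/
def FamilySlide (f f' : Fin k → List (Fin n)) : Prop :=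
  ∃ (W : Fin k → List (Fin n)) (a b : Fin n) (i j : Fin k) (p q : ℕ),
    (W i)[p]? = some b ∧ (W j)[q]? = some b ∧ (i, p) ≠ (j, q) ∧
    f = Function.update W i ((W i).insertIdx p a) ∧
    f' = Function.update W j ((W j).insertIdx (q + 1) a)

/-- Equivalence of families of words modulo the 2-term relations. -/
def FamilyEquiv (f f' : Fin k → List (Fin n)) : Prop := Relation.EqvGen FamilySlide f f'

theorem sum_count_update (f : Fin k → List (Fin n)) (i : Fin k) (w : List (Fin n)) (c : Fin n) :
    ∑ l, (Function.update f i w l).count c + (f i).count c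
      = ∑ l, (f l).count c + w.count c := by
  rw [← Finset.add_sum_erase _ _ (Finset.mem_univ i),
    ← Finset.add_sum_erase Finset.univ (fun l => (f l).count c) (Finset.mem_univ i)]
  have : ∑ l ∈ Finset.univ.erase i, (Function.update f i w l).count c
      = ∑ l ∈ Finset.univ.erase i, (f l).count c :=
    Finset.sum_congr rfl fun l hl => by rw [Function.update_of_ne (Finset.ne_of_mem_erase hl)]
  rw [this, Function.update_self]
  omega

theorem FamilySlide.sum_count {f f' : Fin k → List (Fin n)} (h : FamilySlide f f') (c : Fin n) :
    ∑ l, (f l).count c = ∑ l, (f' l).count c := by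
  obtain ⟨W, a, b, i, j, p, q, hp, hq, -, rfl, rfl⟩ := h
  have h1 := sum_count_update W i ((W i).insertIdx p a) c
  have h2 := sum_count_update W j ((W j).insertIdx (q + 1) a) c
  obtain ⟨hp, -⟩ := List.getElem?_eq_some_iff.1 hp
  obtain ⟨hq, -⟩ := List.getElem?_eq_some_iff.1 hq
  rw [(List.perm_insertIdx a _ hp.le).count_eq, List.count_cons] at h1
  rw [(List.perm_insertIdx a _ hq).count_eq, List.count_cons] at h2
  omega

/-- Slides preserve the number of ends of each chord, so every intermediate family in a chain of
slides that starts at a diagram is again a diagram. This allows all further work to be done with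
bare families of words. -/
theorem FamilyEquiv.exists_diagram {f f' : Fin k → List (Fin n)} (h : FamilyEquiv f f') :
    (∀ c, ∑ l, (f l).count c = ∑ l, (f' l).count c) ∧
      ∀ D D' : ChordDiagram k n, D.word = f → D'.word = f' → TwoTermEquiv D D' := by
  induction h with
  | rel f f' h =>
    refine ⟨h.sum_count, ?_⟩
    rintro D D' rfl rfl
    exact .rel _ _ h
  | refl f =>
    refine ⟨fun _ => rfl, ?_⟩
    rintro D D' rfl h
    obtain rfl : D' = D := ChordDiagram.ext h
    exact .refl _
  | symm f f' _ ih =>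
    exact ⟨fun c => (ih.1 c).symm, fun D D' h h' => .symm _ _ (ih.2 D' D h' h)⟩
  | trans f f' f'' _ _ ih ih' =>
    refine ⟨fun c => (ih.1 c).trans (ih'.1 c), ?_⟩
    rintro D D' rfl rfl
    let E : ChordDiagram k n := ⟨f', fun c => (ih.1 c).symm.trans (D.two_endpoints c)⟩
    exact .trans _ E _ (ih.2 D E rfl rfl) (ih'.2 E D' rfl rfl)

namespace FamilyEquiv

theorem refl (f : Fin k → List (Fin n)) : FamilyEquiv f f := Relation.EqvGen.refl f

theorem symm {f f' : Fin k → List (Fin n)} (h : FamilyEquiv f f') : FamilyEquiv f' f :=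
  Relation.EqvGen.symm _ _ h

theorem trans {f f' f'' : Fin k → List (Fin n)} (h : FamilyEquiv f f')
    (h' : FamilyEquiv f' f'') : FamilyEquiv f f'' := Relation.EqvGen.trans _ _ _ h h'

end FamilyEquiv

theorem insertIdx_length_append {α : Type*} (u v : List α) (a : α) :
    (u ++ v).insertIdx u.length a = u ++ a :: v := by
  induction u with
  | nil => simp
  | cons x u ih => simpa using ih

theorem WordSlide.familySlide {w w' : List (Fin n)} (h : WordSlide w w')
    (f : Fin k → List (Fin n)) (i : Fin k) :
    FamilySlide (Function.update f i w) (Function.update f i w') := by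
  cases h with
  | across u v t x b =>
    refine ⟨Function.update f i (u ++ b :: (v ++ b :: t)), x, b, i, i, u.length,
      (u ++ b :: v).length, ?_, ?_, ?_, ?_, ?_⟩
    · simp
    · rw [Function.update_self,
        show u ++ b :: (v ++ b :: t) = (u ++ b :: v) ++ b :: t by simp]
      simp
    · simp
    · rw [Function.update_self, Function.update_idem, insertIdx_length_append]
    · have := insertIdx_length_append (u ++ b :: v ++ [b]) t x
      simp only [List.length_append, List.length_cons, List.length_nil, List.append_assoc,
        List.cons_append, List.nil_append, zero_add] at this ⊢
      rw [Function.update_self, Function.update_idem, add_assoc, this]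
  | inside u v t x b =>
    refine ⟨Function.update f i (u ++ b :: (v ++ b :: t)), x, b, i, i,
      (u ++ b :: v).length, u.length, ?_, ?_, ?_, ?_, ?_⟩
    · rw [Function.update_self,
        show u ++ b :: (v ++ b :: t) = (u ++ b :: v) ++ b :: t by simp]
      simp
    · simp
    · simp
    · have := insertIdx_length_append (u ++ b :: v) (b :: t) x
      simp at this
      simp [this]
    · have := insertIdx_length_append (u ++ [b]) (v ++ b :: t) x
      simp at this
      simp [this]

theorem WordEquiv.familyEquiv {w w' : List (Fin n)} (h : WordEquiv w w')
    (f : Fin k → List (Fin n)) (i : Fin k) :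
    FamilyEquiv (Function.update f i w) (Function.update f i w') := by
  induction h with
  | rel _ _ h => exact .rel _ _ (h.familySlide f i)
  | refl => exact .refl _
  | symm _ _ _ ih => exact ih.symm
  | trans _ _ _ _ _ ih ih' => exact ih.trans ih'

theorem familySlide_of_ne (f : Fin k → List (Fin n)) {i j : Fin k} (hij : i ≠ j)
    (u v u' v' : List (Fin n)) (a b : Fin n) :
    FamilySlide (Function.update (Function.update f i (u ++ a :: b :: v)) j (u' ++ b :: v'))
      (Function.update (Function.update f i (u ++ b :: v)) j (u' ++ b :: a :: v')) := by
  refine ⟨Function.update (Function.update f i (u ++ b :: v)) j (u' ++ b :: v'), a, b, i, j,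
    u.length, u'.length, ?_, ?_, ?_, ?_, ?_⟩
  · simp [hij]
  · simp
  · simp [hij]
  · rw [Function.update_of_ne hij, Function.update_self, insertIdx_length_append,
      Function.update_comm hij, Function.update_comm hij, Function.update_idem]
  · have := insertIdx_length_append (u' ++ [b]) v' a
    simp at this
    simp [this]

/-- The ends below the chord `b` on component `i` slide over `b` to component `j`. -/
theorem FamilyEquiv.slide_from_below (f : Fin k → List (Fin n)) {i j : Fin k} (hij : i ≠ j)
    (u l v u' v' : List (Fin n)) (b : Fin n) :
    FamilyEquiv
      (Function.update (Function.update f i (u ++ l ++ b :: v)) j (u' ++ b :: v'))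
      (Function.update (Function.update f i (u ++ b :: v)) j (u' ++ b :: (l ++ v'))) := by
  induction l using List.reverseRecOn generalizing v' with
  | nil => simpa using .refl _
  | append_singleton l a ih =>
    have h : FamilyEquiv _ _ := .rel _ _ (familySlide_of_ne f hij (u ++ l) v u' v' a b)
    simpa using h.trans (ih (a :: v'))

/-- The ends above the chord `b` on component `i` slide over `b` to component `j`. -/
theorem FamilyEquiv.slide_from_above (f : Fin k → List (Fin n)) {i j : Fin k} (hij : i ≠ j)
    (u l v u' v' : List (Fin n)) (b : Fin n) :
    FamilyEquiv
      (Function.update (Function.update f i (u ++ b :: (l ++ v))) j (u' ++ b :: v'))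
      (Function.update (Function.update f i (u ++ b :: v)) j (u' ++ l ++ b :: v')) := by
  have := (slide_from_below f hij.symm u' l v' u v b).symm
  rwa [Function.update_comm hij.symm, Function.update_comm hij.symm] at this

end Slides

/-! ### Contracting a connected diagram to a star -/

section Contraction

variable {k n : ℕ}

/-- Every component outside `S` can be reached from every other one by chords that avoid `S`. -/
def ConnectedOff (f : Fin k → List (Fin n)) (S : Finset (Fin k)) : Prop :=
  ∀ x ∉ S, ∀ y ∉ S,
    Relation.ReflTransGen (fun x y => x ∉ S ∧ y ∉ S ∧ ∃ c, c ∈ f x ∧ c ∈ f y) x y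

/-- A path through `i` is rerouted through `j`, which has inherited all chords of `i`. -/
theorem ConnectedOff.contract {f f' : Fin k → List (Fin n)} {S : Finset (Fin k)}
    (h : ConnectedOff f S) {i j : Fin k} (hij : i ≠ j) (hj : j ∉ S)
    (hi' : ∀ c ∈ f i, c ∈ f' j) (hf : ∀ l, l ≠ i → ∀ c ∈ f l, c ∈ f' l) :
    ConnectedOff f' (insert i S) := by
  have key : ∀ x, ∀ y, Relation.ReflTransGen
      (fun x y => x ∉ S ∧ y ∉ S ∧ ∃ c, c ∈ f x ∧ c ∈ f y) x y →
      Relation.ReflTransGen (fun x y => x ∉ insert i S ∧ y ∉ insert i S ∧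
        ∃ c, c ∈ f' x ∧ c ∈ f' y) (if x = i then j else x) (if y = i then j else y) := by
    intro x y hxy
    refine Relation.ReflTransGen.lift (fun x => if x = i then j else x) ?_ _ _ hxy
    rintro x y ⟨hx, hy, c, hcx, hcy⟩
    have hS : ∀ x ∉ S, (if x = i then j else x) ∉ insert i S := by
      intro x hx
      split_ifs with h
      · simp [hij.symm, hj]
      · simp [h, hx]
    have hc : ∀ x, c ∈ f x → c ∈ f' (if x = i then j else x) := by
      intro x hx
      split_ifs with h
      · exact hi' c (h ▸ hx)
      · exact hf x h c hx
    exact ⟨hS x hx, hS y hy, c, hc x hcx, hc y hcy⟩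
  intro x hx y hy
  simp only [Finset.mem_insert, not_or] at hx hy
  have := key x y (h x hx.2 y hy.2)
  rwa [if_neg hx.1, if_neg hy.1] at this

theorem exists_ne_of_reflTransGen {α : Type*} {r : α → α → Prop} {x y : α}
    (h : Relation.ReflTransGen r x y) (hxy : x ≠ y) : ∃ u v, r u v ∧ u ≠ v := by
  by_contra! hr
  refine hxy ?_
  clear hxy
  induction h with
  | refl => rfl
  | tail _ h ih => exact ih.trans (hr _ _ h)

/-- Sliding everything but the chord itself over a chord from component `i` to component `j`. -/
theorem FamilyEquiv.exists_contract (f : Fin k → List (Fin n)) {i j : Fin k} (hij : i ≠ j)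
    {c : Fin n} (hi : c ∈ f i) (hj : c ∈ f j) :
    ∃ f', FamilyEquiv f f' ∧ f' i = [c] ∧ (∀ d ∈ f i, d ∈ f' j) ∧ (∀ d ∈ f j, d ∈ f' j) ∧
      ∀ l, l ≠ i → l ≠ j → f' l = f l := by
  obtain ⟨u, v, hu⟩ := List.append_of_mem hi
  obtain ⟨u', v', hu'⟩ := List.append_of_mem hj
  refine ⟨Function.update (Function.update f i [c]) j (u' ++ v ++ c :: (u ++ v')),
    ?_, ?_, ?_, ?_, ?_⟩
  · have h1 := FamilyEquiv.slide_from_below f hij [] u v u' v' c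
    have h2 := FamilyEquiv.slide_from_above f hij [] v [] u' (u ++ v') c
    have h0 : Function.update (Function.update f i ([] ++ u ++ c :: v)) j (u' ++ c :: v') = f := by
      rw [List.nil_append, ← hu, ← hu', Function.update_eq_self, Function.update_eq_self]
    rw [h0] at h1
    simp only [List.append_nil] at h2
    exact h1.trans h2
  · simp [hij]
  · intro d hd
    rw [hu] at hd
    simp at hd ⊢
    tauto
  · intro d hd
    rw [hu'] at hd
    simp at hd ⊢
    tauto
  · intro l hi hj
    simp [hi, hj]

/-- A connected family of words is equivalent to one in which all components except one carry
a single chord end, the other end being on the exceptional component. -/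
theorem ConnectedOff.exists_star {f : Fin k → List (Fin n)} {S : Finset (Fin k)}
    (h : ConnectedOff f S) (hne : ∃ r, r ∉ S)
    (hS : ∀ i ∈ S, ∃ z, f i = [z] ∧ ∃ j ∉ S, z ∈ f j) :
    ∃ f' r, FamilyEquiv f f' ∧ ∀ i, i ≠ r → ∃ z, f' i = [z] ∧ z ∈ f' r := by
  -- `S` collects the components already stripped to one end; each step strips one more. The other
  -- end of a stripped component's chord may move, but it stays outside `S`.
  induction hm : Sᶜ.card generalizing f S with
  | zero =>
    obtain ⟨r, hr⟩ := hne
    simp [Finset.card_eq_zero, Finset.compl_eq_empty_iff] at hm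
    simp [hm] at hr
  | succ m ih =>
    by_cases hone : ∃ x, x ∉ S ∧ ∃ y, y ∉ S ∧ x ≠ y
    · obtain ⟨x, hx, y, hy, hxy⟩ := hone
      obtain ⟨i, j, ⟨hi, hj, c, hci, hcj⟩, hij⟩ := exists_ne_of_reflTransGen (h x hx y hy) hxy
      obtain ⟨f', hf', hfi, hfij, hfjj, hfl⟩ := FamilyEquiv.exists_contract f hij hci hcj
      have hsub : ∀ l, l ≠ i → ∀ d ∈ f l, d ∈ f' l := by
        intro l hl d hd
        by_cases hlj : l = j
        · subst hlj
          exact hfjj d hd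
        · rwa [hfl l hl hlj]
      obtain ⟨g, r, hg, hr⟩ := ih (h.contract hij hj hfij hsub) ⟨j, by simp [hij.symm, hj]⟩ (by
        intro l hl
        by_cases hli : l = i
        · subst hli
          exact ⟨c, hfi, j, by simp [hij.symm, hj], hfij c hci⟩
        · have hlS : l ∈ S := by simpa [hli] using hl
          obtain ⟨z, hz, l', hl', hzl'⟩ := hS l hlS
          refine ⟨z, ?_, ?_⟩
          · rw [hfl l hli (by rintro rfl; exact hj hlS), hz]
          · by_cases hl'i : l' = i
            · subst hl'i
              exact ⟨j, by simp [hij.symm, hj], hfij z hzl'⟩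
            · exact ⟨l', by simp [hl'i, hl'], hsub l' hl'i z hzl'⟩) (by
        rw [Finset.compl_insert, Finset.card_erase_of_mem (by simpa using hi), hm]
        rfl)
      exact ⟨g, r, hf'.trans hg, hr⟩
    · push Not at hone
      obtain ⟨r, hr⟩ := hne
      refine ⟨f, r, .refl f, fun i hi => ?_⟩
      have hiS : i ∈ S := by
        by_contra hiS
        exact hi (hone i hiS r hr)
      obtain ⟨z, hz, j, hj, hzj⟩ := hS i hiS
      exact ⟨z, hz, hone r hr j hj ▸ hzj⟩

theorem IsConnected.connectedOff {D : ChordDiagram k n} (hD : D.IsConnected) :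
    ConnectedOff D.word ∅ := by
  intro x _ y _
  have h := (SimpleGraph.reachable_iff_reflTransGen x y).1 (hD.preconnected x y)
  refine Relation.ReflTransGen.mono ?_ _ _ h
  rintro a b ⟨-, h⟩
  refine ⟨by simp, by simp, ?_⟩
  rcases h with ⟨c, h1, h2⟩ | ⟨c, h1, h2⟩
  · exact ⟨c, h1, h2⟩
  · exact ⟨c, h2, h1⟩

end Contraction
-- Unfolding a tail into a chain
section Chain

variable {k n : ℕ}

/-- The family of words is equivalent to one in which the listed components form a chain, the
first one of them carrying `pre` at its bottom and `top` at its top, and all other components are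
unchanged. The word `N m` lists the chords from the `m`-th component of the chain to the previous
one. -/
def UnfoldsToChain (f : Fin k → List (Fin n)) (pre top : List (Fin n)) (cs : List (Fin k)) :
    Prop :=
  ∃ (f' : Fin k → List (Fin n)) (N : ℕ → List (Fin n)), FamilyEquiv f f' ∧
    (∀ i ∉ cs, f' i = f i) ∧ N 0 = top ∧ N cs.length = [] ∧ (∀ m, 1 ≤ m → (N m).length ≤ 2) ∧
    ∀ (m : ℕ) (i : Fin k), cs[m]? = some i →
      f' i = (if m = 0 then pre else []) ++ N (m + 1) ++ N m

theorem UnfoldsToChain.cons {f f₁ : Fin k → List (Fin n)} {pre link top : List (Fin n)}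
    {c d : Fin k} {cs : List (Fin k)} (h : UnfoldsToChain f₁ [] link (d :: cs))
    (hlink : link.length ≤ 2) (hf₁ : FamilyEquiv f f₁) (hc : f₁ c = pre ++ link ++ top)
    (hf : ∀ i, i ≠ c → i ≠ d → f₁ i = f i) (hcs : c ∉ d :: cs) :
    UnfoldsToChain f pre top (c :: d :: cs) := by
  obtain ⟨f', N, h1, h2, h3, h4, h5, h6⟩ := h
  refine ⟨f', fun m => Nat.casesOn m top N, hf₁.trans h1, ?_, rfl, h4, ?_, ?_⟩
  · intro i hi
    rw [List.mem_cons, not_or] at hi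
    rw [h2 i hi.2, hf i hi.1 fun h => hi.2 (by simp [h])]
  · rintro (_ | _ | m) hm
    · omega
    · simpa [h3] using hlink
    · exact h5 _ (by omega)
  · rintro (_ | m) i hi
    · obtain rfl : c = i := by simpa using hi
      change f' c = pre ++ N 0 ++ top
      rw [h2 c hcs, hc, h3]
    · simpa using h6 m i (by simpa using hi)

/-- The words over a leg `x` of component `c` slide to the component to which `x` leads. -/
theorem UnfoldsToChain.of_leg {f : Fin k → List (Fin n)} {g : Fin n → Fin k}
    {pre p l top : List (Fin n)} {c : Fin k} {x : Fin n} {zs : List (Fin n)}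
    (hp : p.length ≤ 1) (hc : f c = pre ++ p ++ x :: (l ++ top))
    (hg : ∀ z ∈ x :: zs, g z ≠ c ∧ f (g z) = [z]) (hnd : (x :: zs).Nodup)
    (h : ∀ f₁ : Fin k → List (Fin n), f₁ (g x) = l ++ [x] →
      (∀ z ∈ zs, g z ≠ g x ∧ f₁ (g z) = [z]) →
      UnfoldsToChain f₁ [] (p ++ [x]) (g x :: zs.map g)) :
    UnfoldsToChain f pre top (c :: (x :: zs).map g) := by
  obtain ⟨hxc, hfx⟩ := hg x (by simp)
  -- Ends directly above `x` on `c` arrive directly below `x` on `g x`. Thus `p` and `x` remain on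
  -- `c` as the lower ends of the link, with `top` above them.
  set f₁ := Function.update (Function.update f c (pre ++ p ++ x :: top)) (g x) (l ++ [x])
    with hf₁
  have hf : ∀ i, i ≠ c → i ≠ g x → f₁ i = f i := fun i h h' => by simp [hf₁, h, h']
  rw [List.map_cons]
  refine (h f₁ (by simp [hf₁]) fun z hz => ?_).cons (c := c) (f := f) (by simpa using hp) ?_
    (by simp [hf₁, hxc.symm]) hf ?_
  · obtain ⟨hzc, hfz⟩ := hg z (by simp [hz])
    have hzx : g z ≠ g x := by
      intro h
      rw [h, hfx] at hfz
      obtain rfl : x = z := by simpa using hfz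
      exact (List.nodup_cons.1 hnd).1 hz
    exact ⟨hzx, by rw [hf _ hzc hzx, hfz]⟩
  · have := FamilyEquiv.slide_from_above f hxc.symm (pre ++ p) l top [] [] x
    rwa [← hc, show [] ++ [x] = f (g x) by simp [hfx], Function.update_eq_self,
      Function.update_eq_self, List.nil_append] at this
  · rw [← List.map_cons]
    intro h
    obtain ⟨z, hz, hzc⟩ := List.mem_map.1 h
    exact (hg z hz).1 hzc

open scoped Classical in
/-- If the ends on component `c` contain a tail and every leg of the tail leads to a component
without further ends, then the tail unfolds into a chain of components. -/
theorem IsTail.unfoldsToChain {L : Fin n → Prop} {T : List (Fin n)} (hT : IsTail L T)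
    (g : Fin n → Fin k) (f : Fin k → List (Fin n)) (c : Fin k) (pre top : List (Fin n))
    (hc : f c = pre ++ T ++ top) (hg : ∀ z ∈ T.filter L, g z ≠ c ∧ f (g z) = [z])
    (hnd : (T.filter L).Nodup) :
    UnfoldsToChain f pre top (c :: (T.filter L).map g) := by
  induction hT generalizing f c pre top with
  | nil =>
    -- The chain ends at `c`: `top` leads back and no link leads on.
    refine ⟨f, fun m => Nat.casesOn m top fun _ => [], .refl f, fun _ _ => rfl, rfl, rfl, ?_, ?_⟩
    · rintro (_ | m) hm
      · omega
      · simp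
    · rintro (_ | m) i hi
      · obtain rfl : c = i := by simpa using hi
        simpa using hc
      · simp at hi
  | @leg z T hz hT ih =>
    have hx : (z :: T).filter L = z :: T.filter L := by simp [hz]
    rw [hx] at hg hnd ⊢
    refine .of_leg (p := []) (l := T) (by simp) (by simpa using hc) hg hnd fun f₁ h₁ h₂ => ?_
    exact ih f₁ (g z) [] [z] (by simpa using h₁) h₂ (List.nodup_cons.1 hnd).2
  | @hump a x T ha hx' hT ih =>
    have hx : (a :: x :: (T ++ [a])).filter L = x :: T.filter L := by simp [hx', ha]
    rw [hx] at hg hnd ⊢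
    -- The lower end of `a` stays and the upper one slides over `x`, so `[a, x]` occurs in the same
    -- order on both components: the two chords do not cross.
    refine .of_leg (p := [a]) (l := T ++ [a]) (by simp) (by simpa using hc) hg hnd
      fun f₁ h₁ h₂ => ?_
    exact ih f₁ (g x) [] [a, x] (by simpa using h₁) h₂ (List.nodup_cons.1 hnd).2

theorem nodup_cons_map {α : Type*} {r : α} {l : List (Fin n)} {g : Fin n → α}
    (hl : l.Nodup) (hr : ∀ z ∈ l, g z ≠ r) (hg : ∀ z ∈ l, ∀ z' ∈ l, g z = g z' → z = z') :
    (r :: l.map g).Nodup := by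
  rw [List.nodup_cons]
  refine ⟨fun h => ?_, hl.map_on hg⟩
  obtain ⟨z, hz, h⟩ := List.mem_map.1 h
  exact hr z hz h

end Chain

/-! ### Recognizing and reaching the normal form -/

section NormalForm

variable {k n : ℕ}

/-- Both sides sum to 2 over all components, so the inequalities are equalities. -/
theorem joins_of_count {D : ChordDiagram k n} {c : Fin n} {i j : Fin k}
    (h : ∀ l, (if l = i then 1 else 0) + (if l = j then 1 else 0) ≤ (D.word l).count c) :
    D.Joins c i j := by
  have hs : ∑ l, ((if l = i then 1 else 0) + (if l = j then 1 else 0)) =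
      ∑ l, (D.word l).count c := by
    rw [D.two_endpoints, Finset.sum_add_distrib]
    simp
  intro l
  exact ((Finset.sum_eq_sum_iff_of_le fun l _ => h l).1 hs l (Finset.mem_univ l)).symm

theorem below_of_append {D : ChordDiagram k n} {i : Fin k} {A B : List (Fin n)} {c d : Fin n}
    (h : D.word i = A ++ B) (hc : c ∉ B) (hd : d ∉ A) : D.Below i c d := by
  intro p q hp hq
  rw [h] at hp hq
  by_contra! hpq
  by_cases hpA : p < A.length
  · rw [List.getElem?_append_left (by omega)] at hq
    exact hd (List.mem_of_getElem? hq)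
  · rw [List.getElem?_append_right (by omega)] at hp
    exact hc (List.mem_of_getElem? hp)

/-- A diagram whose components form a chain with links `N m` between the components `m - 1` and
`m` and with a caravan `K` below on the first one is in normal form. -/
theorem isNormalForm_of_chain {D : ChordDiagram k n} {K : List (Fin n)} (hK : IsCaravan K)
    {N : ℕ → List (Fin n)} (h0 : N 0 = []) (hk : N k = [])
    (hN : ∀ m, 1 ≤ m → (N m).length ≤ 2)
    (hD : ∀ i : Fin k, D.word i = (if i.val = 0 then K else []) ++ N (i.val + 1) ++ N i.val) :
    D.IsNormalForm := by
  have hcount : ∀ (i : Fin k) (c : Fin n), (D.word i).count c =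
      (if i.val = 0 then K else []).count c + (N (i.val + 1)).count c + (N i.val).count c := by
    intro i c
    rw [hD, List.count_append, List.count_append]
  have hloop : ∀ i : Fin k, i.val = 0 → ∀ c ∈ K, D.Joins c i i := by
    intro i hi c hc
    refine joins_of_count fun l => ?_
    split_ifs with hl
    · subst hl
      have := hK.two_le_count hc
      rw [hcount, if_pos hi]
      omega
    · simp
  have hlink : ∀ i j : Fin k, j.val = i.val + 1 → ∀ c ∈ N (i.val + 1), D.Joins c i j := by
    intro i j hij c hc
    have h1 := List.count_pos_iff.2 hc
    refine joins_of_count fun l => ?_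
    split_ifs with hl hl' hl'
    · have := congrArg Fin.val (hl.symm.trans hl')
      omega
    · subst hl
      rw [hcount]
      omega
    · subst hl'
      rw [hcount, hij]
      omega
    · simp
  have hcases : ∀ c : Fin n, (∃ i : Fin k, i.val = 0 ∧ c ∈ K) ∨
      ∃ i j : Fin k, j.val = i.val + 1 ∧ c ∈ N (i.val + 1) := by
    intro c
    obtain ⟨i, hi⟩ : ∃ i, c ∈ D.word i := by
      by_contra! h
      have := D.two_endpoints c
      simp [List.count_eq_zero.2 (h _)] at this
    rw [hD, List.mem_append, List.mem_append] at hi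
    rcases hi with (hi | hi) | hi
    · split_ifs at hi with h
      · exact .inl ⟨i, h, hi⟩
      · simp at hi
    · have hik : i.val + 1 < k := by
        by_contra h
        rw [show i.val + 1 = k by omega, hk] at hi
        simp at hi
      exact .inr ⟨i, ⟨_, hik⟩, rfl, hi⟩
    · obtain ⟨i, hik⟩ := i
      obtain _ | m := i
      · simp [h0] at hi
      · exact .inr ⟨⟨m, by omega⟩, ⟨m + 1, hik⟩, rfl, hi⟩
  have hmemN : ∀ i j : Fin k, j.val = i.val + 1 → ∀ c, D.Joins c i j → c ∈ N (i.val + 1) := by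
    intro i j hij c hc
    rcases hcases c with ⟨l, hl, h⟩ | ⟨l, m, hlm, h⟩
    · have h1 := hloop l hl c h
      have h2 := hc l
      rw [h1 l] at h2
      simp only [Fin.ext_iff] at h2
      split_ifs at h2 <;> omega
    · have h1 := hlink l m hlm c h
      have h2 := hc l
      have h3 := hc m
      rw [h1 l] at h2
      rw [h1 m] at h3
      have : l.val = i.val := by
        simp only [Fin.ext_iff] at h2 h3
        split_ifs at h2 h3 <;> omega
      rwa [← this]
  have hmemK : ∀ i : Fin k, i.val = 0 → ∀ c, D.Joins c i i → c ∈ K := by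
    intro i hi c hc
    rcases hcases c with ⟨l, hl, h⟩ | ⟨l, m, hlm, h⟩
    · exact h
    · have h1 := hlink l m hlm c h
      have h2 := hc m
      rw [h1 m] at h2
      simp only [Fin.ext_iff] at h2
      split_ifs at h2 <;> omega
  have hone : ∀ i j : Fin k, j.val = i.val + 1 → ∀ c, D.Joins c i j →
      (D.word i).count c = 1 ∧ (D.word j).count c = 1 := by
    intro i j hij c hc
    have : i ≠ j := by
      rintro rfl
      omega
    rw [hc i, hc j]
    simp [this, this.symm]
  have htwo : ∀ i : Fin k, ∀ c, D.Joins c i i → (D.word i).count c = 2 := by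
    intro i c hc
    rw [hc i]
    simp
  refine ⟨?_, ?_, ?_, ?_, ?_, ?_⟩
  · intro c
    rcases hcases c with ⟨i, hi, h⟩ | ⟨i, j, hij, h⟩
    · exact .inl ⟨i, hi, hloop i hi c h⟩
    · exact .inr ⟨i, j, hij, hlink i j hij c h⟩
  · intro i hi
    suffices D.loopWord i = K by rwa [this]
    have hw : D.word i = K ++ N 1 := by rw [hD, if_pos hi, hi, h0, List.append_nil]
    rw [loopWord]
    conv_lhs => arg 2; rw [hw]
    rw [List.filter_append, List.filter_eq_self.2, List.filter_eq_nil_iff.2, List.append_nil]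
    · intro c hc
      have hi1 : c ∈ N (i.val + 1) := by rwa [hi]
      have hik : i.val + 1 < k := by
        by_contra h
        rw [show i.val + 1 = k by omega, hk] at hi1
        simp at hi1
      have := (hone i ⟨_, hik⟩ rfl c (hlink i ⟨_, hik⟩ rfl c hi1)).1
      simp [this]
    · intro c hc
      simpa using htwo i c (hloop i hi c hc)
  · intro i hi c d hc hd
    have hw : D.word i = K ++ (N (i.val + 1) ++ N i.val) := by
      rw [hD, if_pos hi, List.append_assoc]
    refine below_of_append hw ?_ fun h => hd (hloop i hi d h)
    have h1 := hK.two_le_count (hmemK i hi c hc)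
    have h2 := htwo i c hc
    rw [hw, List.count_append] at h2
    rw [← List.count_eq_zero]
    omega
  · intro i j hij
    have : {c : Fin n | D.Joins c i j} ⊆ ((N (i.val + 1)).toFinset : Set (Fin n)) := by
      intro c hc
      simpa using hmemN i j hij c hc
    refine (Set.ncard_le_ncard this).trans ?_
    rw [Set.ncard_coe_finset]
    exact (List.toFinset_card_le _).trans (hN _ (by omega))
  · intro i j hij c d hcd hc hd
    have key : ∀ c d : Fin n, D.Joins c i j → D.Joins d i j → N (i.val + 1) = [c, d] →
        D.Below i c d ∧ D.Below j c d := by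
      intro c d hc hd h
      have hb : ∀ l (A B : List (Fin n)), D.word l = A ++ [c, d] ++ B →
          (D.word l).count c = 1 → (D.word l).count d = 1 → D.Below l c d := by
        intro l A B hl hlc hld
        refine below_of_append (A := A ++ [c]) (B := [d] ++ B) (by simp [hl]) ?_ ?_
        all_goals
          rw [hl] at hlc hld
          rw [← List.count_eq_zero]
          simp only [List.count_append, List.count_cons, List.count_nil, beq_self_eq_true,
            if_true] at hlc hld ⊢
          omega
      refine ⟨hb i (if i.val = 0 then K else []) (N i.val) ?_ (hone i j hij c hc).1
        (hone i j hij d hd).1, hb j (N (j.val + 1)) [] ?_ (hone i j hij c hc).2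
        (hone i j hij d hd).2⟩
      · rw [hD, h]
      · rw [hD, if_neg (by omega), ← h, ← hij]
        simp
    have hc' := hmemN i j hij c hc
    have hd' := hmemN i j hij d hd
    have hl := hN (i.val + 1) (by omega)
    rcases hNi : N (i.val + 1) with _ | ⟨x, _ | ⟨y, _ | ⟨z, l⟩⟩⟩
    · simp [hNi] at hc'
    · simp only [hNi, List.mem_singleton] at hc' hd'
      exact absurd (hc'.trans hd'.symm) hcd
    · simp only [hNi, List.mem_cons, List.not_mem_nil, or_false] at hc' hd'
      rcases hc' with rfl | rfl <;> rcases hd' with rfl | rfl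
      · exact absurd rfl hcd
      · exact .inl (key _ _ hc hd hNi)
      · exact .inr (key _ _ hd hc hNi)
      · exact absurd rfl hcd
    · simp [hNi] at hl
  · intro h i j hih hij c d hc hd
    have hw : D.word i = N (i.val + 1) ++ N i.val := by
      rw [hD, if_neg (by omega), List.nil_append]
    have hd' : D.Joins d h i := fun l => by rw [hd l, add_comm]
    have h1 := List.count_pos_iff.2 (hmemN i j hij c hc)
    have h2 := List.count_pos_iff.2 (hmemN h i hih d hd')
    have h3 := (hone i j hij c hc).1
    have h4 := (hone h i hih d hd').2
    rw [← hih] at h2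
    rw [hw, List.count_append] at h3 h4
    refine below_of_append hw ?_ ?_ <;> rw [← List.count_eq_zero] <;> omega

/-- A diagram in which all components except `r` carry a single chord end, the other end being on
`r`, is equivalent to a diagram in normal form. -/
theorem exists_isNormalForm_of_star (D : ChordDiagram k n) (r : Fin k)
    (hr : ∀ i, i ≠ r → ∃ z, D.word i = [z] ∧ z ∈ D.word r) :
    ∃ (D' : ChordDiagram k n) (σ : Equiv.Perm (Fin k)),
      TwoTermEquiv D D' ∧ (D'.renumber σ).IsNormalForm := by
  classical
  have : Nonempty (Fin k) := ⟨r⟩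
  -- The legs are the chords that lead from `r` to a component of their own; `g` sends a leg to that
  -- component.
  obtain ⟨L, hLdef⟩ : ∃ L : Fin n → Prop, ∀ z, L z ↔ ∃ i, i ≠ r ∧ D.word i = [z] :=
    ⟨_, fun _ => Iff.rfl⟩
  obtain ⟨g, hg⟩ : ∃ g : Fin n → Fin k, ∀ z, L z → g z ≠ r ∧ D.word (g z) = [z] := by
    choose! g hg using fun z (hz : L z) => (hLdef z).1 hz
    exact ⟨g, hg⟩
  have hsum : ∀ c, (D.word r).count c + ∑ i ∈ Finset.univ.erase r, (D.word i).count c = 2 := by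
    intro c
    rw [← D.two_endpoints c]
    exact Finset.add_sum_erase _ (fun i => (D.word i).count c) (Finset.mem_univ r)
  have hclosed : IsClosedWord L (D.word r) := by
    intro c hc
    have hpos := List.count_pos_iff.2 hc
    refine ⟨fun hL => ?_, fun hL => ?_⟩
    · obtain ⟨i, hi, hci⟩ := (hLdef c).1 hL
      have h1 : 1 ≤ ∑ i ∈ Finset.univ.erase r, (D.word i).count c :=
        le_trans (by simp [hci]) (Finset.single_le_sum (f := fun i => (D.word i).count c)
          (fun _ _ => Nat.zero_le _) (Finset.mem_erase.2 ⟨hi, Finset.mem_univ i⟩))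
      have := hsum c
      omega
    · rw [← hsum c, Finset.sum_eq_zero, add_zero]
      intro i hi
      obtain ⟨z, hz, -⟩ := hr i (Finset.ne_of_mem_erase hi)
      rw [List.count_eq_zero, hz, List.mem_singleton]
      rintro rfl
      exact hL ((hLdef _).2 ⟨i, Finset.ne_of_mem_erase hi, hz⟩)
  obtain ⟨K, T, hK, hT, hw⟩ := hclosed.hasCaravanForm
  have hclosed' := hclosed.perm hw.perm
  have hcount : ∀ z ∈ K ++ T, L z → K.count z = 0 ∧ T.count z = 1 := by
    intro z hz hL
    have h1 := (hclosed' z hz).1 hL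
    rw [List.count_append] at h1
    have h2 : z ∉ K := fun h => by
      have := hK.two_le_count h
      omega
    rw [← List.count_eq_zero] at h2
    omega
  have hmem : ∀ z ∈ T.filter L, z ∈ T ∧ L z := fun z hz => by simpa using hz
  have hnd : (T.filter L).Nodup := by
    rw [List.nodup_iff_count_le_one]
    intro z
    by_cases hz : z ∈ T.filter L
    · obtain ⟨hzT, hL⟩ := hmem z hz
      exact (List.filter_sublist.count_le z).trans
        (hcount z (List.mem_append_right _ hzT) hL).2.le
    · simp [List.count_eq_zero.2 hz]
  obtain ⟨f', N, h1, -, h3, h4, h5, h6⟩ := hT.unfoldsToChain g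
    (Function.update D.word r (K ++ T)) r K [] (by simp) (fun z hz => by
      have := hg z (hmem z hz).2
      exact ⟨this.1, by rw [Function.update_of_ne this.1, this.2]⟩) hnd
  have hequiv : FamilyEquiv D.word f' := by
    have := hw.familyEquiv D.word r
    rw [Function.update_eq_self] at this
    exact this.trans h1
  set cs := r :: (T.filter L).map g with hcs
  have hcsnd : cs.Nodup := by
    refine nodup_cons_map hnd (fun z hz => (hg z (hmem z hz).2).1) fun z hz z' hz' h => ?_
    have h1 := (hg z (hmem z hz).2).2
    rw [h, (hg z' (hmem z' hz').2).2] at h1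
    simpa using h1.symm
  have hall : ∀ i, i ∈ cs := by
    intro i
    by_cases hi : i = r
    · simp [hcs, hi]
    · obtain ⟨z, hz, hzr⟩ := hr i hi
      have hL : L z := (hLdef z).2 ⟨i, hi, hz⟩
      have hzKT := hw.perm.mem_iff.1 hzr
      have hzT : z ∈ T := List.count_pos_iff.1 (by
        have := (hcount z hzKT hL).2
        omega)
      have hgi : g z = i := by
        -- Otherwise `z` would have three ends, on `r`, `i` and `g z`.
        by_contra hne
        obtain ⟨hgr, hgz⟩ := hg z hL
        have h1 := List.count_pos_iff.2 hzr
        have h2 := Finset.sum_le_sum_of_subset (f := fun i => (D.word i).count z)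
          (show {g z, i} ⊆ Finset.univ.erase r by
            intro l hl
            rcases Finset.mem_insert.1 hl with rfl | hl
            · simp [hgr]
            · simp [Finset.mem_singleton.1 hl, hi])
        rw [Finset.sum_pair hne, hz, hgz] at h2
        have := hsum z
        simp at h2
        omega
      exact List.mem_cons_of_mem _ (List.mem_map.2 ⟨z, by simp [hzT, hL], hgi⟩)
  -- The chain visits every component exactly once, so its order is the required renumbering.
  let e : Fin cs.length ≃ Fin k := hcsnd.getEquivOfForallMemList cs hall
  have hlen : cs.length = k := by simpa using Fintype.card_congr e
  refine ⟨⟨f', fun c => (hequiv.exists_diagram.1 c).symm.trans (D.two_endpoints c)⟩,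
    (finCongr hlen.symm).trans e, hequiv.exists_diagram.2 _ _ rfl rfl,
    isNormalForm_of_chain hK h3 (hlen ▸ h4) h5 fun i => ?_⟩
  refine h6 i.val _ ?_
  rw [List.getElem?_eq_getElem (by omega)]
  rfl

end NormalForm
end ChordDiagram

theorem theoremT (k n : ℕ) (D : ChordDiagram k n) (hD : D.IsConnected) :
    ∃ (D' : ChordDiagram k n) (σ : Equiv.Perm (Fin k)),
      ChordDiagram.TwoTermEquiv D D' ∧ (D'.renumber σ).IsNormalForm := by
  have : Nonempty (Fin k) := hD.nonempty
  obtain ⟨f, r, hf, hr⟩ := hD.connectedOff.exists_star (by simp) (by simp)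
  obtain ⟨hsum, hequiv⟩ := hf.exists_diagram
  obtain ⟨D', σ, h, hσ⟩ := ChordDiagram.exists_isNormalForm_of_star
    ⟨f, fun c => (hsum c).symm.trans (D.two_endpoints c)⟩ r hr
  exact ⟨D', σ, .trans _ _ _ (hequiv D _ rfl rfl) h, hσ⟩
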